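/- Let $n\ge 0$ and let $\mathfrak S_n$ be the symmetric group on $\{1,\dots,n\}$ (products are compositions), with simple transpositions $s_i=(i\ i{+}1)$ for $1\le i\le n-1$, length function $\ell$, and Bruhat covering relation $\lessdot$, where $v\lessdot w$ means that $\ell(v)=\ell(w)-1$ and $v=wt$ for some transposition $t$. A reduced expression for $w$ is a word $s_{i_1}\cdots s_{i_\ell}$ of minimal length with product $w$. The Fomin–Kirillov algebra $\mathcal E_n$ is the associative unital $\mathbb C$-algebra with generators $x_{ij}=-x_{ji}$ ($1\le i,j\le n$, $i\ne j$) and relations, for distinct $i,j,k,l$, $$x_{ij}^2=0,\qquad x_{ij}x_{kl}=x_{kl}x_{ij},\qquad x_{ij}x_{jk}+x_{jk}x_{ki}+x_{ki}x_{ij}=0 .$$ Let $\mathcal E_n^+$ be the set of nonnegative real linear combinations of monomials (including $1$) in the $x_{ij}$ with $i<j$. For $v,w\in\mathfrak S_n$ choose a reduced expression $w=s_{i_1}\cdots s_{i_\ell}$ and define $$x_{w/v}=\sum_J\ \prod_{j\notin J} x_{u_{J,j}^{-1}(i_j),\,u_{J,j}^{-1}(i_j+1)}\in\mathcal E_n,\qquad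 u_{J,j}=\prod_{k\in J,\ k>j}s_{i_k},$$ where $J$ runs over the subsets of $\{1,\dots,\ell\}$ such that $\prod_{j\in J}s_{i_j}$ is a reduced expression for $v$, and all products are taken in increasing order of the index. (Equivalently, $x_{w/v}=v^{-1}\sum_J\prod_{j=1}^{\ell}\varphi_j(J)$ with $\varphi_j(J)=s_{i_j}$ for $j\in J$ and $\varphi_j(J)=x_{i_j,i_j+1}$ for $j\notin J$, using $x_{pq}u=u\,x_{u^{-1}(p)u^{-1}(q)}$ for $u\in\mathfrak S_n$.) Then for all $v,w\in\mathfrak S_n$: 1. $x_{w/v}$ does not depend on the choice of the reduced expression for $w$. 2. Let $1\le i\le n-1$ and suppose $a=v^{-1}(i)<v^{-1}(i+1)=b$. Set $v'=s_iv$ and $w'=s_iw$. If $w\lessdot w'$, then $$x_{w/v}=x_{ab}\,x_{w/v'}+x_{w'/v'};$$ otherwise $$x_{w/v}=x_{ab}\,x_{w/v'}.$$ 3. If $\ell(w)\le\ell(v)$, then $x_{w/v}=1$ if $v=w$ and $x_{w/v}=0$ otherwise. 4. $x_{w/v}\in\mathcal E_n^+$. -/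

import Mathlib

open scoped NNReal

namespace SkewDD

/-! ### Words in the simple transpositions -/

/-- The first index moved by the `i`-th simple transposition. -/
def lo {n : ℕ} (i : Fin (n - 1)) : Fin n := ⟨i.1, by omega⟩

/-- The second index moved by the `i`-th simple transposition, the successor of `lo i`. -/
def hi {n : ℕ} (i : Fin (n - 1)) : Fin n := ⟨i.1 + 1, by omega⟩

/-- The simple transposition `s_i`, exchanging `i` and `i + 1`. Permutations multiply by
composition. -/
def simple {n : ℕ} (i : Fin (n - 1)) : Equiv.Perm (Fin n) := Equiv.swap (lo i) (hi i)

/-- The permutation `s_{i_1} ⋯ s_{i_ℓ}` of the word `[i_1, …, i_ℓ]`. -/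
def wordProd {n : ℕ} (L : List (Fin (n - 1))) : Equiv.Perm (Fin n) := (L.map simple).prod

/-- `L` is a reduced expression for `w`: its product is `w` and no word with product `w` is
shorter. -/
def IsReducedExpr {n : ℕ} (L : List (Fin (n - 1))) (w : Equiv.Perm (Fin n)) : Prop :=
  wordProd L = w ∧ ∀ M : List (Fin (n - 1)), wordProd M = w → L.length ≤ M.length

theorem exists_word {n : ℕ} (w : Equiv.Perm (Fin n)) :
    ∃ L : List (Fin (n - 1)), wordProd L = w := by
  cases n with
  | zero => exact ⟨[], Subsingleton.elim _ _⟩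
  | succ m =>
    have h : w ∈ Submonoid.closure
        (Set.range fun i : Fin m => Equiv.swap i.castSucc i.succ) := by
      rw [Equiv.Perm.mclosure_swap_castSucc_succ]; trivial
    induction h using Submonoid.closure_induction with
    | mem x hx =>
      obtain ⟨i, rfl⟩ := hx
      refine ⟨[i], ?_⟩
      simp only [wordProd, List.map_cons, List.map_nil, List.prod_cons, List.prod_nil, mul_one]
      rfl
    | one => exact ⟨[], rfl⟩
    | mul x y _ _ hx hy =>
      obtain ⟨L, rfl⟩ := hx
      obtain ⟨M, rfl⟩ := hy
      exact ⟨L ++ M, by simp [wordProd]⟩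

theorem exists_reducedExpr {n : ℕ} (w : Equiv.Perm (Fin n)) :
    ∃ L : List (Fin (n - 1)), IsReducedExpr L w := by
  classical
  have h : ∃ k : ℕ, ∃ L : List (Fin (n - 1)), wordProd L = w ∧ L.length = k := by
    obtain ⟨L, hL⟩ := exists_word w
    exact ⟨L.length, L, hL, rfl⟩
  obtain ⟨L, hL, hk⟩ := Nat.find_spec h
  exact ⟨L, hL, fun M hM => hk ▸ Nat.find_min' h ⟨M, hM, rfl⟩⟩

/-- A chosen reduced expression for `w`. -/
noncomputable def reducedExpr {n : ℕ} (w : Equiv.Perm (Fin n)) : List (Fin (n - 1)) :=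
  (exists_reducedExpr w).choose

/-- The length `ℓ(w)`: the common length of all reduced expressions for `w`. -/
noncomputable def len {n : ℕ} (w : Equiv.Perm (Fin n)) : ℕ := (reducedExpr w).length

/-- The covering relation `v ⋖ w` of the Bruhat order: `ℓ(v) = ℓ(w) - 1` and `v = w s_{ij}` for
some transposition `s_{ij}`. -/
def BruhatCovBy {n : ℕ} (v w : Equiv.Perm (Fin n)) : Prop :=
  len v + 1 = len w ∧ ∃ i j : Fin n, i ≠ j ∧ v = w * Equiv.swap i j

/-! ### The Fomin–Kirillov algebra -/

/-- A free generator for each pair of indices. -/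
noncomputable def freeGen {n : ℕ} (i j : Fin n) : FreeAlgebra ℂ (Fin n × Fin n) :=
  FreeAlgebra.ι ℂ (i, j)

/-- The defining relations of the Fomin–Kirillov algebra. The generators are `x_{ij}` with
`i ≠ j`; the relation `diag` removes the symbols `x_{ii}`, which are there only so that
`x_{ij}` makes sense for all `i` and `j`. -/
inductive FKRel (n : ℕ) :
    FreeAlgebra ℂ (Fin n × Fin n) → FreeAlgebra ℂ (Fin n × Fin n) → Prop
  | diag (i : Fin n) : FKRel n (freeGen i i) 0
  | antisymm (i j : Fin n) (hij : i ≠ j) : FKRel n (freeGen i j) (-freeGen j i)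
  | sq (i j : Fin n) (hij : i ≠ j) : FKRel n (freeGen i j * freeGen i j) 0
  | comm (i j k l : Fin n) (hij : i ≠ j) (hik : i ≠ k) (hil : i ≠ l) (hjk : j ≠ k)
      (hjl : j ≠ l) (hkl : k ≠ l) :
      FKRel n (freeGen i j * freeGen k l) (freeGen k l * freeGen i j)
  | triangle (i j k : Fin n) (hij : i ≠ j) (hjk : j ≠ k) (hik : i ≠ k) :
      FKRel n (freeGen i j * freeGen j k + freeGen j k * freeGen k i
        + freeGen k i * freeGen i j) 0

/-- The Fomin–Kirillov algebra over `ℂ`. -/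
abbrev FK (n : ℕ) : Type := RingQuot (FKRel n)

/-- The element `x_{ij}` of the Fomin–Kirillov algebra. -/
noncomputable def x {n : ℕ} (i j : Fin n) : FK n :=
  RingQuot.mkAlgHom ℂ (FKRel n) (freeGen i j)

/-- The cone of positive elements: nonnegative real linear combinations of monomials (including
the empty one) in the `x_{ij}` with `i < j`. -/
noncomputable def FKpos (n : ℕ) : Submodule ℝ≥0 (FK n) :=
  Submodule.span ℝ≥0
    (Submonoid.closure {y : FK n | ∃ i j : Fin n, i < j ∧ y = x i j} : Set (FK n))

/-! ### Skew elements -/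

/-- The subword of `L` at the positions satisfying `p`. -/
def subword {n : ℕ} (L : List (Fin (n - 1))) (p : Fin L.length → Prop) [DecidablePred p] :
    List (Fin (n - 1)) :=
  ((List.finRange L.length).filter (fun k => decide (p k))).map L.get

/-- Let `L = [i_1, …, i_ℓ]`. In the product `φ_1 ⋯ φ_ℓ` with `φ_j = s_{i_j}` for `j ∈ J` and
`φ_j = x_{i_j, i_j + 1}` for `j ∉ J`, move all transpositions to the left by the rule
`x_{pq} u = u x_{u⁻¹(p) u⁻¹(q)}`. The result is `(∏_{j ∈ J} s_{i_j}) · skewTerm L J`, where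
`skewTerm L J` is the product, in order, over `j ∉ J` of `x_{u⁻¹(i_j) u⁻¹(i_j + 1)}`, with `u` the
product of the `s_{i_k}` over `k ∈ J`, `k > j`. -/
noncomputable def skewTerm {n : ℕ} (L : List (Fin (n - 1))) (J : Finset (Fin L.length)) : FK n :=
  (((List.finRange L.length).filter (fun j => decide (j ∉ J))).map fun j =>
    x ((wordProd (subword L fun k => k ∈ J ∧ j < k))⁻¹ (lo (L.get j)))
      ((wordProd (subword L fun k => k ∈ J ∧ j < k))⁻¹ (hi (L.get j)))).prod

open Classical in
/-- `v⁻¹ ∑_J φ_J`, computed from the word `L`: the sum is over all sets `J` of positions of `L`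
whose subword is a reduced expression for `v`. -/
noncomputable def skewOfWord {n : ℕ} (L : List (Fin (n - 1))) (v : Equiv.Perm (Fin n)) : FK n :=
  ∑ J : Finset (Fin L.length) with IsReducedExpr (subword L (· ∈ J)) v, skewTerm L J

/-- The skew element `x_{w/v}`, computed from a reduced expression for `w`. -/
noncomputable def xSkew {n : ℕ} (w v : Equiv.Perm (Fin n)) : FK n :=
  skewOfWord (reducedExpr w) v

end SkewDD

namespace SkewDD

/-! ### Simple transpositions and descents -/

section Descents

variable {n : ℕ}

/-! Let the symmetric group act on the Fomin–Kirillov algebra, and form the crossed product in which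
the group part is replaced by the nilCoxeter algebra. Writing an element as `∑ v f(v)`, left
multiplication by `s_i + x_{i,i+1}` becomes the operator `skewOp x i` on coefficient functions.
Splitting the sets `J` by whether they contain the first position shows that a word yields `x_{w/·}`
by applying its operators to the delta function at 1 (`skewOfWord_cons`).

The triangle relations make these operators satisfy the nilCoxeter relations: braid, commutation and
square zero. Matsumoto's theorem then gives independence of the word. Moreover `skewOp x i` sends
`x_{w/·}` to `x_{s_i w/·}` if `i` is no left descent of `w`, and to 0 otherwise. Evaluating this at
`s_i v` and solving for the value at `v` is the recurrence; the sign in `x_{ba} = -x_{ab}` turns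
into a plus.

The initial values come from counting letters. Positivity follows by descending induction on `ℓ(v)`,
since the recurrence only involves the longer `s_i v`. Lengths are handled throughout as inversion
numbers. -/

theorem lo_lt_hi (i : Fin (n - 1)) : lo i < hi i := by simp [lo, hi, Fin.lt_def]

@[simp] theorem simple_mul_self (i : Fin (n - 1)) : simple i * simple i = 1 := by simp [simple]

@[simp] theorem simple_mul_cancel (i : Fin (n - 1)) (w : Equiv.Perm (Fin n)) :
    simple i * (simple i * w) = w := by rw [← mul_assoc, simple_mul_self, one_mul]

@[simp] theorem simple_inv (i : Fin (n - 1)) : (simple i)⁻¹ = simple i := by simp [simple]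

@[simp] theorem simple_lo (i : Fin (n - 1)) : simple i (lo i) = hi i := by simp [simple]

@[simp] theorem simple_hi (i : Fin (n - 1)) : simple i (hi i) = lo i := by simp [simple]

theorem simple_apply_of_ne (i : Fin (n - 1)) {p : Fin n} (h : p.1 ≠ i.1) (h' : p.1 ≠ i.1 + 1) :
    simple i p = p := by
  apply Equiv.swap_apply_of_ne_of_ne
  · intro e; exact h (by rw [e]; rfl)
  · intro e; exact h' (by rw [e]; rfl)

theorem inv_simple_mul_apply (i : Fin (n - 1)) (w : Equiv.Perm (Fin n)) (p : Fin n) :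
    (simple i * w)⁻¹ p = w⁻¹ (simple i p) := by
  rw [mul_inv_rev, simple_inv, Equiv.Perm.mul_apply]

/-- `i` is a left descent of `w`. -/
def IsDesc (i : Fin (n - 1)) (w : Equiv.Perm (Fin n)) : Prop := w⁻¹ (hi i) < w⁻¹ (lo i)

theorem isDesc_simple_mul (i : Fin (n - 1)) (w : Equiv.Perm (Fin n)) :
    IsDesc i (simple i * w) ↔ ¬ IsDesc i w := by
  have : w⁻¹ (lo i) ≠ w⁻¹ (hi i) := fun h => (lo_lt_hi i).ne (w⁻¹.injective h)
  simp only [IsDesc, inv_simple_mul_apply, simple_lo, simple_hi, not_lt]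
  exact ⟨le_of_lt, fun h => lt_of_le_of_ne h this⟩

/-- The pairs of values of `w` that form an inversion. -/
def inversions (w : Equiv.Perm (Fin n)) : Finset (Fin n × Fin n) :=
  Finset.univ.filter fun p => p.1 < p.2 ∧ w⁻¹ p.2 < w⁻¹ p.1

theorem simple_lt_simple {i : Fin (n - 1)} {p q : Fin n} (h : p < q)
    (hne : ¬ (p = lo i ∧ q = hi i)) : simple i p < simple i q := by
  simp only [simple, Equiv.swap_apply_def]
  simp only [lo, hi, Fin.ext_iff, Fin.lt_def] at *
  split_ifs <;> (try dsimp only) <;> omega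

/-- Only the values `i` and `i + 1` change relative order under `s_i`, so the old inversions are
relabelled and exactly one is new. -/
theorem inversions_simple_mul {i : Fin (n - 1)} {w : Equiv.Perm (Fin n)} (h : ¬ IsDesc i w) :
    inversions (simple i * w) = insert (lo i, hi i)
      ((inversions w).map ((simple i).prodCongr (simple i)).toEmbedding) := by
  have hd : IsDesc i (simple i * w) := (isDesc_simple_mul i w).2 h
  ext ⟨p, q⟩
  have hmem : ∀ a b, (a, b) ∈ inversions w ↔ a < b ∧ w⁻¹ b < w⁻¹ a := by
    intro a b; simp [inversions]
  have key : (p, q) ∈ (inversions w).map ((simple i).prodCongr (simple i)).toEmbedding ↔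
      simple i p < simple i q ∧ w⁻¹ (simple i q) < w⁻¹ (simple i p) := by
    rw [Finset.mem_map_equiv, ← hmem]
    have : (simple i).symm = simple i := simple_inv i
    simp [this]
  rw [Finset.mem_insert, key]
  have hL : (p, q) ∈ inversions (simple i * w) ↔
      p < q ∧ w⁻¹ (simple i q) < w⁻¹ (simple i p) := by
    simp [inversions]
  rw [hL, Prod.mk.injEq]
  constructor
  · rintro ⟨h1, h2⟩
    by_cases hne : p = lo i ∧ q = hi i
    · exact Or.inl hne
    · exact Or.inr ⟨simple_lt_simple h1 hne, h2⟩
  · rintro (⟨rfl, rfl⟩ | ⟨h1, h2⟩)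
    · refine ⟨lo_lt_hi i, ?_⟩
      simpa [IsDesc, inv_simple_mul_apply] using hd
    · refine ⟨?_, h2⟩
      by_cases hne : simple i p = lo i ∧ simple i q = hi i
      · rw [hne.1, hne.2] at h2
        exact absurd h2 h
      · have := simple_lt_simple h1 hne
        rwa [← Equiv.Perm.mul_apply, ← Equiv.Perm.mul_apply, simple_mul_self] at this

theorem card_inversions_simple_mul {i : Fin (n - 1)} {w : Equiv.Perm (Fin n)}
    (h : ¬ IsDesc i w) : (inversions (simple i * w)).card = (inversions w).card + 1 := by
  rw [inversions_simple_mul h, Finset.card_insert_of_notMem, Finset.card_map]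
  rw [Finset.mem_map_equiv]
  have : (simple i).symm = simple i := simple_inv i
  simp only [Equiv.prodCongr_symm, this, Equiv.prodCongr_apply, Prod.map_apply, simple_lo,
    simple_hi, inversions, Finset.mem_filter, Finset.mem_univ, true_and]
  exact fun hh => (lo_lt_hi i).not_gt hh.1

theorem card_inversions_of_isDesc {i : Fin (n - 1)} {w : Equiv.Perm (Fin n)}
    (h : IsDesc i w) : (inversions w).card = (inversions (simple i * w)).card + 1 := by
  have := card_inversions_simple_mul (i := i) (w := simple i * w)
    (fun h' => (isDesc_simple_mul i w).1 h' h)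
  rwa [simple_mul_cancel] at this

theorem inversions_one : inversions (1 : Equiv.Perm (Fin n)) = ∅ := by
  ext ⟨p, q⟩
  simp only [inversions, inv_one, Equiv.Perm.coe_one, id_eq, Finset.mem_filter, Finset.mem_univ,
    true_and, Finset.notMem_empty, iff_false]
  exact fun h => h.1.not_gt h.2

/-- Without descents `w⁻¹` is increasing, and the only order automorphism of a finite chain is the
identity. -/
theorem eq_one_of_forall_not_isDesc {w : Equiv.Perm (Fin n)} (h : ∀ i, ¬ IsDesc i w) :
    w = 1 := by
  cases n with
  | zero => exact Subsingleton.elim _ _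
  | succ m =>
    have hm : StrictMono (w⁻¹ : Equiv.Perm (Fin (m + 1))) := by
      rw [Fin.strictMono_iff_lt_succ]
      intro i
      refine lt_of_le_of_ne (not_lt.1 (h i)) fun e => ?_
      exact (Fin.castSucc_lt_succ (i := i)).ne (w⁻¹.injective e)
    have : StrictMono.orderIsoOfSurjective _ hm w⁻¹.surjective = OrderIso.refl _ :=
      Subsingleton.elim _ _
    rw [← inv_eq_one]
    ext p
    have := congrArg (fun e => e p) this
    simpa using congrArg Fin.val this

theorem inversions_of_forall_isDesc {w : Equiv.Perm (Fin n)} (h : ∀ i, IsDesc i w) :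
    inversions w = Finset.univ.filter fun p => p.1 < p.2 := by
  cases n with
  | zero => ext ⟨p, q⟩; exact p.elim0
  | succ m =>
    have hm : StrictAnti (w⁻¹ : Equiv.Perm (Fin (m + 1))) := by
      rw [Fin.strictAnti_iff_succ_lt]
      exact fun i => h i
    ext ⟨p, q⟩
    simp only [inversions, Finset.mem_filter, Finset.mem_univ, true_and, and_iff_left_iff_imp]
    exact fun hpq => hm hpq

theorem card_inversions_le (w : Equiv.Perm (Fin n)) :
    (inversions w).card ≤ (Finset.univ.filter fun p : Fin n × Fin n => p.1 < p.2).card :=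
  Finset.card_le_card fun p hp => by
    simp only [inversions, Finset.mem_filter, Finset.mem_univ, true_and] at hp ⊢
    exact hp.1

end Descents

/-! ### Reduced words -/

section ReducedWords

variable {n : ℕ}

@[simp] theorem wordProd_nil : wordProd ([] : List (Fin (n - 1))) = 1 := rfl

@[simp] theorem wordProd_cons (i : Fin (n - 1)) (L : List (Fin (n - 1))) :
    wordProd (i :: L) = simple i * wordProd L := by simp [wordProd]

theorem card_inversions_wordProd_le (L : List (Fin (n - 1))) :
    (inversions (wordProd L)).card ≤ L.length := by
  induction L with
  | nil => simp [inversions_one]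
  | cons i L ih =>
    rw [wordProd_cons, List.length_cons]
    by_cases h : IsDesc i (wordProd L)
    · have := card_inversions_of_isDesc h
      omega
    · have := card_inversions_simple_mul h
      omega

/-- Bubble sort: stripping a left descent removes one inversion, and a descent exists unless `w =
1`. -/
theorem exists_word_length_eq (w : Equiv.Perm (Fin n)) :
    ∃ L : List (Fin (n - 1)), wordProd L = w ∧ L.length = (inversions w).card := by
  induction hk : (inversions w).card generalizing w with
  | zero =>
    refine ⟨[], ?_, rfl⟩
    rw [eq_one_of_forall_not_isDesc (w := w) fun i hi => ?_, wordProd_nil]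
    have := card_inversions_of_isDesc hi
    omega
  | succ k ih =>
    obtain ⟨i, hi⟩ : ∃ i, IsDesc i w := by
      by_contra! hne
      rw [eq_one_of_forall_not_isDesc hne, inversions_one] at hk
      simp at hk
    have := card_inversions_of_isDesc hi
    obtain ⟨L, hL, hl⟩ := ih (simple i * w) (by omega)
    exact ⟨i :: L, by rw [wordProd_cons, hL, simple_mul_cancel], by rw [List.length_cons, hl]⟩

theorem isReducedExpr_iff {L : List (Fin (n - 1))} {w : Equiv.Perm (Fin n)} :
    IsReducedExpr L w ↔ wordProd L = w ∧ L.length = (inversions w).card := by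
  constructor
  · rintro ⟨rfl, h⟩
    obtain ⟨M, hM, hl⟩ := exists_word_length_eq (wordProd L)
    exact ⟨rfl, le_antisymm (hl ▸ h M hM) (card_inversions_wordProd_le L)⟩
  · rintro ⟨h, hl⟩
    refine ⟨h, fun M hM => ?_⟩
    rw [hl, ← hM]
    exact card_inversions_wordProd_le M

theorem reducedExpr_spec (w : Equiv.Perm (Fin n)) : IsReducedExpr (reducedExpr w) w :=
  (exists_reducedExpr w).choose_spec

theorem len_eq_card_inversions (w : Equiv.Perm (Fin n)) : len w = (inversions w).card :=
  (isReducedExpr_iff.1 (reducedExpr_spec w)).2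

theorem isReducedExpr_nil {w : Equiv.Perm (Fin n)} : IsReducedExpr [] w ↔ w = 1 := by
  rw [isReducedExpr_iff, wordProd_nil]
  constructor
  · exact fun h => h.1.symm
  · rintro rfl
    simp [inversions_one]

/-- Each letter changes the inversion number by exactly one, so a word is reduced precisely when
every letter, read from the right, raises it. -/
theorem isReducedExpr_cons {i : Fin (n - 1)} {L : List (Fin (n - 1))}
    {w : Equiv.Perm (Fin n)} :
    IsReducedExpr (i :: L) w ↔ IsDesc i w ∧ IsReducedExpr L (simple i * w) := by
  have hw : wordProd (i :: L) = w ↔ wordProd L = simple i * w := by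
    rw [wordProd_cons]
    constructor
    · rintro rfl; rw [simple_mul_cancel]
    · intro h; rw [h, simple_mul_cancel]
  rw [isReducedExpr_iff, isReducedExpr_iff, hw, List.length_cons]
  constructor
  · rintro ⟨h, hl⟩
    by_cases hd : IsDesc i w
    · have := card_inversions_of_isDesc hd
      exact ⟨hd, h, by omega⟩
    · have h1 := card_inversions_simple_mul hd
      have h2 := card_inversions_wordProd_le L
      rw [h] at h2
      omega
  · rintro ⟨hd, h, hl⟩
    have := card_inversions_of_isDesc hd
    exact ⟨h, by omega⟩

theorem bruhatCovBy_simple_mul {i : Fin (n - 1)} {w : Equiv.Perm (Fin n)} :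
    BruhatCovBy w (simple i * w) ↔ ¬ IsDesc i w := by
  rw [BruhatCovBy, len_eq_card_inversions, len_eq_card_inversions]
  constructor
  · rintro ⟨h, -⟩ hd
    have := card_inversions_of_isDesc hd
    omega
  · intro hd
    refine ⟨(card_inversions_simple_mul hd).symm, w⁻¹ (lo i), w⁻¹ (hi i), fun e =>
      (lo_lt_hi i).ne (w⁻¹.injective e), ?_⟩
    -- Conjugating `s_i` by `w` moves it to the right as a transposition, so only the length
    -- condition of the cover carries information.
    rw [mul_assoc, Equiv.mul_swap_eq_swap_mul]
    simp [simple]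

/-! ### Braid relations and Matsumoto's theorem -/

theorem simple_commute {i j : Fin (n - 1)} (h : i.1 + 1 < j.1) :
    simple i * simple j = simple j * simple i := by
  apply Equiv.Perm.Disjoint.commute
  intro p
  by_cases hp : p.1 = i.1 ∨ p.1 = i.1 + 1
  · exact Or.inr (simple_apply_of_ne j (by omega) (by omega))
  · exact Or.inl (simple_apply_of_ne i (by omega) (by omega))

theorem lo_eq_hi {i j : Fin (n - 1)} (h : i.1 + 1 = j.1) : lo j = hi i := by
  simp [lo, hi, h]

theorem simple_hi_succ {i j : Fin (n - 1)} (h : i.1 + 1 = j.1) : simple i (hi j) = hi j :=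
  simple_apply_of_ne i (by simp [hi]; omega) (by simp [hi]; omega)

theorem simple_lo_pred {i j : Fin (n - 1)} (h : i.1 + 1 = j.1) : simple j (lo i) = lo i :=
  simple_apply_of_ne j (by simp [lo]; omega) (by simp [lo]; omega)

theorem simple_lo_far {i j : Fin (n - 1)} (h : i.1 + 1 < j.1 ∨ j.1 + 1 < i.1) :
    simple i (lo j) = lo j :=
  simple_apply_of_ne i (by simp [lo]; omega) (by simp [lo]; omega)

theorem simple_hi_far {i j : Fin (n - 1)} (h : i.1 + 1 < j.1 ∨ j.1 + 1 < i.1) :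
    simple i (hi j) = hi j :=
  simple_apply_of_ne i (by simp [hi]; omega) (by simp [hi]; omega)

theorem simple_braid {i j : Fin (n - 1)} (h : i.1 + 1 = j.1) :
    simple i * (simple j * simple i) = simple j * (simple i * simple j) := by
  ext p
  simp only [Equiv.Perm.mul_apply]
  congr 1
  have e1 := lo_eq_hi h
  have e2 := simple_hi_succ h
  have e3 := simple_lo_pred h
  have e4 : simple j (hi i) = hi j := by rw [← e1, simple_lo]
  have e5 : simple j (hi j) = hi i := by rw [simple_hi, e1]
  by_cases h1 : p = lo i
  · simp [h1, e2, e3, e4]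
  by_cases h2 : p = hi i
  · simp [h2, e1, e2, e3, e4]
  by_cases h3 : p = hi j
  · simp [h3, e2, e3, e5]
  have hp1 : p.1 ≠ i.1 := fun e => h1 (Fin.ext e)
  have hp2 : p.1 ≠ i.1 + 1 := fun e => h2 (Fin.ext e)
  have hp3 : p.1 ≠ j.1 + 1 := fun e => h3 (Fin.ext e)
  have f1 : simple i p = p := simple_apply_of_ne i hp1 hp2
  have f2 : simple j p = p := simple_apply_of_ne j (by omega) hp3
  simp [f1, f2]

/-- Matsumoto's theorem for the symmetric group: elements satisfying the braid relations have
the same product along any two reduced words of a permutation. -/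
theorem prod_eq_of_isReducedExpr {A : Type*} [Monoid A] (t : Fin (n - 1) → A)
    (hcomm : ∀ i j : Fin (n - 1), i.1 + 1 < j.1 → t i * t j = t j * t i)
    (hbraid : ∀ i j : Fin (n - 1), i.1 + 1 = j.1 → t i * (t j * t i) = t j * (t i * t j))
    {L M : List (Fin (n - 1))} {w : Equiv.Perm (Fin n)}
    (hL : IsReducedExpr L w) (hM : IsReducedExpr M w) :
    (L.map t).prod = (M.map t).prod := by
  induction hk : L.length using Nat.strong_induction_on generalizing L M w with
  | _ k ih =>
  have hlen : L.length = M.length :=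
    (isReducedExpr_iff.1 hL).2.trans (isReducedExpr_iff.1 hM).2.symm
  -- Distinct commuting first letters: a reduced tail `N` of `s_j s_i w` gives words `i j N` and `j
  -- i N`, which the induction compares with the given ones.
  have hfar : ∀ (i j : Fin (n - 1)) (L M : List (Fin (n - 1))), i.1 + 1 < j.1 →
      IsReducedExpr (i :: L) w → IsReducedExpr (j :: M) w → L.length + 1 = k →
      M.length + 1 = k →
      ((i :: L).map t).prod = ((j :: M).map t).prod := by
    intro i j L M hij hL hM hkL hkM
    rw [isReducedExpr_cons] at hL hM
    have hdj : IsDesc j (simple i * w) := by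
      simpa [IsDesc, inv_simple_mul_apply, simple_lo_far (Or.inl hij),
        simple_hi_far (Or.inl hij)] using hM.1
    have hdi : IsDesc i (simple j * w) := by
      simpa [IsDesc, inv_simple_mul_apply, simple_lo_far (Or.inr hij),
        simple_hi_far (Or.inr hij)] using hL.1
    obtain ⟨N, hN⟩ := exists_reducedExpr (simple j * (simple i * w))
    have h1 := ih L.length (by omega) hL.2 (isReducedExpr_cons.2 ⟨hdj, hN⟩) rfl
    rw [← mul_assoc, ← simple_commute hij, mul_assoc] at hN
    have h2 := ih M.length (by omega) hM.2 (isReducedExpr_cons.2 ⟨hdi, hN⟩) rfl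
    simp only [List.map_cons, List.prod_cons] at h1 h2 ⊢
    rw [h1, h2, ← mul_assoc, hcomm i j hij, mul_assoc]
  -- Adjacent first letters: `w⁻¹` decreases on three consecutive values, so `w` has reduced words
  -- `i j i N` and `j i j N` with a common tail.
  have hadj : ∀ (i j : Fin (n - 1)) (L M : List (Fin (n - 1))), i.1 + 1 = j.1 →
      IsReducedExpr (i :: L) w → IsReducedExpr (j :: M) w → L.length + 1 = k →
      M.length + 1 = k →
      ((i :: L).map t).prod = ((j :: M).map t).prod := by
    intro i j L M hij hL hM hkL hkM
    rw [isReducedExpr_cons] at hL hM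
    have e1 := lo_eq_hi hij
    have e2 := simple_hi_succ hij
    have e3 := simple_lo_pred hij
    have e4 : simple j (hi i) = hi j := by rw [← e1, simple_lo]
    have d1 : w⁻¹ (hi i) < w⁻¹ (lo i) := hL.1
    have d2 : w⁻¹ (hi j) < w⁻¹ (hi i) := by simpa [IsDesc, e1] using hM.1
    have a1 : IsDesc j (simple i * w) := by
      simpa [IsDesc, inv_simple_mul_apply, e1, e2] using d2.trans d1
    have a2 : IsDesc i (simple j * (simple i * w)) := by
      simpa [IsDesc, inv_simple_mul_apply, e1, e2, e3, e4] using d2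
    have b1 : IsDesc i (simple j * w) := by
      simpa [IsDesc, inv_simple_mul_apply, e3, e4] using d2.trans d1
    have b2 : IsDesc j (simple i * (simple j * w)) := by
      simpa [IsDesc, inv_simple_mul_apply, e1, e2, e3, e4] using d1
    obtain ⟨N, hN⟩ := exists_reducedExpr (simple i * (simple j * (simple i * w)))
    have h1 := ih L.length (by omega) hL.2
      (isReducedExpr_cons.2 ⟨a1, isReducedExpr_cons.2 ⟨a2, hN⟩⟩) rfl
    have hb : simple i * (simple j * (simple i * w)) = simple j * (simple i * (simple j * w)) := by
      have := congrArg (· * w) (simple_braid hij)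
      simpa only [mul_assoc] using this
    rw [hb] at hN
    have h2 := ih M.length (by omega) hM.2
      (isReducedExpr_cons.2 ⟨b1, isReducedExpr_cons.2 ⟨b2, hN⟩⟩) rfl
    simp only [List.map_cons, List.prod_cons] at h1 h2 ⊢
    have := congrArg (· * (N.map t).prod) (hbraid i j hij)
    simp only [mul_assoc] at this
    rw [h1, h2, this]
  match L, M, hL, hM, hk, hlen with
  | [], [], _, _, _, _ => rfl
  | i :: L, j :: M, hL, hM, hk, hlen =>
    simp only [List.length_cons] at hk hlen
    rcases lt_trichotomy i j with h | rfl | h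
    · rcases Nat.lt_or_ge (i.1 + 1) j.1 with h' | h'
      · exact hfar i j L M h' hL hM hk (by omega)
      · exact hadj i j L M (by have := Fin.lt_def.1 h; omega) hL hM hk (by omega)
    · rw [isReducedExpr_cons] at hL hM
      rw [List.map_cons, List.map_cons, List.prod_cons, List.prod_cons,
        ih L.length (by omega) hL.2 hM.2 rfl]
    · rcases Nat.lt_or_ge (j.1 + 1) i.1 with h' | h'
      · exact (hfar j i M L h' hM hL (by omega) hk).symm
      · exact (hadj j i M L (by have := Fin.lt_def.1 h; omega) hM hL (by omega) hk).symm

end ReducedWords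

/-! ### Relations in the Fomin–Kirillov algebra -/

/-- A family of elements satisfying the relations of the Fomin–Kirillov algebra. -/
structure IsFKFamily {n : ℕ} {A : Type*} [Semiring A] (X : Fin n → Fin n → A) : Prop where
  antisymm (i j : Fin n) : i ≠ j → X i j + X j i = 0
  sq (i j : Fin n) : i ≠ j → X i j * X i j = 0
  comm (i j k l : Fin n) : i ≠ j → i ≠ k → i ≠ l → j ≠ k → j ≠ l → k ≠ l →
    X i j * X k l = X k l * X i j
  triangle (i j k : Fin n) : i ≠ j → j ≠ k → i ≠ k →
    X i j * X j k + X j k * X k i + X k i * X i j = 0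

theorem isFKFamily_x (n : ℕ) : IsFKFamily (x : Fin n → Fin n → FK n) where
  antisymm i j h := by
    have h1 : x i j = RingQuot.mkAlgHom ℂ (FKRel n) (-freeGen j i) :=
      RingQuot.mkAlgHom_rel ℂ (FKRel.antisymm i j h)
    have h2 : -freeGen j i + freeGen j i = 0 := neg_add_cancel _
    rw [h1, x, ← map_add, h2, map_zero]
  sq i j h := by
    rw [x, ← map_mul, RingQuot.mkAlgHom_rel ℂ (FKRel.sq i j h), map_zero]
  comm i j k l hij hik hil hjk hjl hkl := by
    rw [x, x, ← map_mul, RingQuot.mkAlgHom_rel ℂ (FKRel.comm i j k l hij hik hil hjk hjl hkl),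
      map_mul]
  triangle i j k hij hjk hik := by
    rw [x, x, x, ← map_mul, ← map_mul, ← map_mul, ← map_add, ← map_add,
      RingQuot.mkAlgHom_rel ℂ (FKRel.triangle i j k hij hjk hik), map_zero]

namespace IsFKFamily

variable {n : ℕ} {A : Type*} [Ring A] {X : Fin n → Fin n → A}

theorem eq_neg (hX : IsFKFamily X) {i j : Fin n} (h : i ≠ j) : X i j = - X j i :=
  eq_neg_of_add_eq_zero_left (hX.antisymm i j h)

/-- The triangle relation solved for one product. -/
theorem mul_eq (hX : IsFKFamily X) {p q r : Fin n} (hpq : p ≠ q) (hqr : q ≠ r) (hpr : p ≠ r) :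
    X p q * X q r = X p r * X p q + X q r * X p r := by
  have h := hX.triangle p q r hpq hqr hpr
  rw [hX.eq_neg hpr.symm] at h
  rw [← sub_eq_zero, ← h]
  noncomm_ring

/-- Multiply the solved triangle relation by `X q r` on the left, or by `X p q` on the right: a
square dies each time, and both results are `X q r * X p r * X p q`. -/
theorem braid (hX : IsFKFamily X) {p q r : Fin n} (hpq : p ≠ q) (hqr : q ≠ r) (hpr : p ≠ r) :
    X p q * (X q r * X p q) = X q r * (X p q * X q r) := by
  have h1 : X q r * (X p q * X q r) = X q r * (X p r * X p q) := by
    rw [hX.mul_eq hpq hqr hpr, mul_add, ← mul_assoc (X q r) (X q r), hX.sq q r hqr, zero_mul,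
      add_zero]
  have h2 : X p q * X q r * X p q = X q r * X p r * X p q := by
    rw [hX.mul_eq hpq hqr hpr, add_mul, mul_assoc (X p r), hX.sq p q hpq, mul_zero, zero_add]
  rw [h1, ← mul_assoc, ← mul_assoc, h2]

end IsFKFamily

/-! ### The nilCoxeter operators -/

section Operators

variable {n : ℕ}

/-- Left multiplication by `s_i + X_{i, i + 1}` in the crossed product of an algebra containing
a family `X` as in the Fomin–Kirillov algebra and the nilCoxeter algebra, an element `∑_v v f(v)`
being given by its coefficients. -/
def skewOp {A : Type*} [Semiring A] (X : Fin n → Fin n → A) (i : Fin (n - 1)) :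
    Function.End (Equiv.Perm (Fin n) → A) :=
  -- The condition is the nilCoxeter truncation: `s_i · (s_i v)` contributes to `v` only when the
  -- length goes up.
  fun f v => (if v⁻¹ (hi i) < v⁻¹ (lo i) then f (simple i * v) else 0) +
    X (v⁻¹ (lo i)) (v⁻¹ (hi i)) * f v

theorem skewOp_apply_of_isDesc {A : Type*} [Semiring A] (X : Fin n → Fin n → A) {i : Fin (n - 1)}
    {v : Equiv.Perm (Fin n)} (h : IsDesc i v) (f : Equiv.Perm (Fin n) → A) :
    skewOp X i f v = f (simple i * v) + X (v⁻¹ (lo i)) (v⁻¹ (hi i)) * f v :=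
  congrArg (· + _) (if_pos h)

theorem skewOp_apply_of_not_isDesc {A : Type*} [Semiring A] (X : Fin n → Fin n → A)
    {i : Fin (n - 1)} {v : Equiv.Perm (Fin n)} (h : ¬ IsDesc i v)
    (f : Equiv.Perm (Fin n) → A) :
    skewOp X i f v = X (v⁻¹ (lo i)) (v⁻¹ (hi i)) * f v :=
  (congrArg (· + _) (if_neg h)).trans (zero_add _)

variable {A : Type*} [Ring A] {X : Fin n → Fin n → A}

theorem inv_lo_ne_inv_hi (i : Fin (n - 1)) (v : Equiv.Perm (Fin n)) :
    v⁻¹ (lo i) ≠ v⁻¹ (hi i) := fun e => (lo_lt_hi i).ne (v⁻¹.injective e)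

/-- This is the recurrence for an arbitrary `f`: passing from `v` to `s_i v` reverses the indices of
`X`, hence its sign. -/
theorem skewOp_simple_mul (hX : IsFKFamily X) {i : Fin (n - 1)} {v : Equiv.Perm (Fin n)}
    (h : ¬ IsDesc i v) (f : Equiv.Perm (Fin n) → A) :
    f v = X (v⁻¹ (lo i)) (v⁻¹ (hi i)) * f (simple i * v) + skewOp X i f (simple i * v) := by
  rw [skewOp_apply_of_isDesc X ((isDesc_simple_mul i v).2 h), simple_mul_cancel,
    inv_simple_mul_apply, inv_simple_mul_apply, simple_lo, simple_hi,
    hX.eq_neg (inv_lo_ne_inv_hi i v).symm, neg_mul]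
  abel

theorem skewOp_skewOp (hX : IsFKFamily X) (i : Fin (n - 1)) (f : Equiv.Perm (Fin n) → A) :
    skewOp X i (skewOp X i f) = 0 := by
  funext v
  have hs : ∀ z : A, X (v⁻¹ (lo i)) (v⁻¹ (hi i)) * (X (v⁻¹ (lo i)) (v⁻¹ (hi i)) * z) = 0 :=
    fun z => by rw [← mul_assoc, hX.sq _ _ (inv_lo_ne_inv_hi i v), zero_mul]
  by_cases h : IsDesc i v
  · have h' : ¬ IsDesc i (simple i * v) := fun h' => (isDesc_simple_mul i v).1 h' h
    rw [skewOp_apply_of_isDesc X h, skewOp_apply_of_not_isDesc X h', skewOp_apply_of_isDesc X h,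
      mul_add, hs, inv_simple_mul_apply, inv_simple_mul_apply, simple_lo, simple_hi,
      hX.eq_neg (inv_lo_ne_inv_hi i v).symm, neg_mul, add_zero, neg_add_cancel]
    rfl
  · rw [skewOp_apply_of_not_isDesc X h, skewOp_apply_of_not_isDesc X h, hs]
    rfl

theorem skewOp_comm (hX : IsFKFamily X) {i j : Fin (n - 1)} (h : i.1 + 1 < j.1) :
    skewOp X i * skewOp X j = skewOp X j * skewOp X i := by
  funext f v
  have l1 := simple_lo_far (Or.inl h)
  have l2 := simple_hi_far (Or.inl h)
  have l3 := simple_lo_far (Or.inr h)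
  have l4 := simple_hi_far (Or.inr h)
  have hc : ∀ z : A, X (v⁻¹ (lo i)) (v⁻¹ (hi i)) * (X (v⁻¹ (lo j)) (v⁻¹ (hi j)) * z) =
      X (v⁻¹ (lo j)) (v⁻¹ (hi j)) * (X (v⁻¹ (lo i)) (v⁻¹ (hi i)) * z) := fun z => by
    rw [← mul_assoc, ← mul_assoc, hX.comm] <;>
      · rw [v⁻¹.injective.ne_iff, Ne, Fin.ext_iff]
        simp only [lo, hi]
        omega
  have hs : simple i * (simple j * v) = simple j * (simple i * v) := by
    rw [← mul_assoc, simple_commute h, mul_assoc]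
  change skewOp X i (skewOp X j f) v = skewOp X j (skewOp X i f) v
  simp only [skewOp, inv_simple_mul_apply, l1, l2, l3, l4, hs, mul_add, hc]
  split_ifs <;> (try simp only [mul_zero, zero_add]) <;> abel

/-- Coefficients of each translate of `f` are compared, for every relative order of the values `p,
q, r` of `v⁻¹`. Cubic terms agree by `IsFKFamily.braid`, quadratic ones by the triangle relation. -/
theorem skewOp_braid (hX : IsFKFamily X) {i j : Fin (n - 1)} (h : i.1 + 1 = j.1) :
    skewOp X i * (skewOp X j * skewOp X i) = skewOp X j * (skewOp X i * skewOp X j) := by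
  funext f v
  have e1 := lo_eq_hi h
  have e2 := simple_hi_succ h
  have e3 := simple_lo_pred h
  have e4 : simple j (hi i) = hi j := by rw [← e1, simple_lo]
  have e5 : simple j (hi j) = hi i := by rw [simple_hi, e1]
  have hs : simple i * (simple j * (simple i * v)) = simple j * (simple i * (simple j * v)) := by
    have := congrArg (· * v) (simple_braid h)
    simpa only [mul_assoc] using this
  change skewOp X i (skewOp X j (skewOp X i f)) v = skewOp X j (skewOp X i (skewOp X j f)) v
  have hpq := inv_lo_ne_inv_hi i v
  have hqr := inv_lo_ne_inv_hi j v
  rw [e1] at hqr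
  have hpr : v⁻¹ (lo i) ≠ v⁻¹ (hi j) := fun e => by
    have := congrArg Fin.val (v⁻¹.injective e)
    simp only [lo, hi] at this
    omega
  simp only [skewOp, inv_simple_mul_apply, e1, e2, e3, e4, e5, simple_lo, simple_hi, hs,
    simple_mul_cancel]
  generalize v⁻¹ (lo i) = p at *
  generalize v⁻¹ (hi i) = q at *
  generalize v⁻¹ (hi j) = r at *
  have hb : ∀ z : A, X p q * (X q r * (X p q * z)) = X q r * (X p q * (X q r * z)) :=
    fun z => by
      have := congrArg (· * z) (hX.braid hpq hqr hpr)
      simpa only [mul_assoc] using this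
  have ht : ∀ z : A, X p q * (X q r * z) = X p r * (X p q * z) + X q r * (X p r * z) :=
    fun z => by
      have := congrArg (· * z) (hX.mul_eq hpq hqr hpr)
      simpa only [mul_assoc, add_mul] using this
  -- The triangle relation for the reversed triple `r, q, p`; the signs cancel in pairs.
  have ht' : ∀ z : A, X q r * (X p q * z) = X p q * (X p r * z) + X p r * (X q r * z) :=
    fun z => by
      have := congrArg (· * z) (hX.mul_eq hqr.symm hpq.symm hpr.symm)
      rw [hX.eq_neg hqr.symm, hX.eq_neg hpq.symm, hX.eq_neg hpr.symm] at this
      simp only [neg_mul_neg, add_mul, mul_assoc] at this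
      rw [this, add_comm]
  rw [hX.eq_neg hpq.symm, hX.eq_neg hqr.symm]
  rcases lt_or_gt_of_ne hpq with a | a <;> rcases lt_or_gt_of_ne hqr with b | b <;>
    rcases lt_or_gt_of_ne hpr with c | c <;>
    first
    -- Two of the eight sign patterns are cyclic and cannot occur.
    | (exfalso; order)
    | (simp only [a, b, c, a.not_gt, b.not_gt, c.not_gt, if_true, if_false, mul_add, zero_add,
        neg_mul, mul_neg, hb]
       try simp only [ht, ht']
       try abel)

end Operators

/-! ### Skew elements from words -/

section Skew

variable {n : ℕ}

theorem sum_finset_fin_succ {M : Type*} [AddCommMonoid M] {m : ℕ} (F : Finset (Fin (m + 1)) → M) :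
    ∑ J, F J = ∑ J : Finset (Fin m), F (insert 0 (J.map (Fin.succEmb m))) +
      ∑ J : Finset (Fin m), F (J.map (Fin.succEmb m)) := by
  classical
  have h : (0 : Fin (m + 1)) ∉ Finset.univ.map (Fin.succEmb m) := by simp
  have hu : (Finset.univ : Finset (Fin (m + 1))) = insert 0 (Finset.univ.map (Fin.succEmb m)) := by
    rw [Fin.univ_succ]; ext; simp
  rw [← Finset.powerset_univ, hu, Finset.sum_powerset_insert h, add_comm, Finset.map_eq_image,
    Finset.powerset_image, Finset.sum_image, Finset.sum_image, Finset.powerset_univ]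
  · simp only [Finset.map_eq_image]
  all_goals
    intro a _ b _ hab
    exact Finset.image_injective (Fin.succEmb m).injective hab

theorem subword_cons (i : Fin (n - 1)) (L : List (Fin (n - 1)))
    (p : Fin (L.length + 1) → Prop) [DecidablePred p] :
    subword (i :: L) p =
      if p 0 then i :: subword L (fun k => p k.succ) else subword L (fun k => p k.succ) := by
  unfold subword
  have : List.finRange (i :: L).length = 0 :: (List.finRange L.length).map Fin.succ :=
    List.finRange_succ
  rw [this, List.filter_cons]
  split_ifs with h1 h2 h2 <;>
    simp_all [List.filter_map, Function.comp_def]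

theorem subword_congr (L : List (Fin (n - 1))) {p q : Fin L.length → Prop} [DecidablePred p]
    [DecidablePred q] (h : ∀ k, p k ↔ q k) : subword L p = subword L q := by
  unfold subword
  simp only [h]

/-- The factor of `skewTerm L J` at the position `j`. -/
noncomputable def skewFactor (L : List (Fin (n - 1))) (J : Finset (Fin L.length))
    (j : Fin L.length) : FK n :=
  x ((wordProd (subword L fun k => k ∈ J ∧ j < k))⁻¹ (lo (L.get j)))
    ((wordProd (subword L fun k => k ∈ J ∧ j < k))⁻¹ (hi (L.get j)))

theorem skewTerm_eq (L : List (Fin (n - 1))) (J : Finset (Fin L.length)) :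
    skewTerm L J =
      (((List.finRange L.length).filter (fun j => decide (j ∉ J))).map (skewFactor L J)).prod :=
  rfl

/-- A factor depends only on the chosen positions to its right, so a new first letter leaves the
other factors unchanged. -/
theorem skewTerm_cons (i : Fin (n - 1)) (L : List (Fin (n - 1)))
    (J : Finset (Fin (L.length + 1))) (K : Finset (Fin L.length))
    (hJ : ∀ k, k.succ ∈ J ↔ k ∈ K) :
    skewTerm (i :: L) J = (if 0 ∈ J then 1 else
      x ((wordProd (subword L (· ∈ K)))⁻¹ (lo i)) ((wordProd (subword L (· ∈ K)))⁻¹ (hi i))) *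
        skewTerm L K := by
  have hsucc : ∀ j : Fin L.length, skewFactor (i :: L) J j.succ = skewFactor L K j := by
    intro j
    have : subword (i :: L) (fun k => k ∈ J ∧ j.succ < k) =
        subword L fun k => k ∈ K ∧ j < k := by
      refine (subword_cons i L _).trans ?_
      rw [if_neg (by simp)]
      exact subword_congr L fun k => by rw [hJ, Fin.succ_lt_succ_iff]
    unfold skewFactor
    rw [this]
    rfl
  have hzero : skewFactor (i :: L) J (0 : Fin (L.length + 1)) =
      x ((wordProd (subword L (· ∈ K)))⁻¹ (lo i)) ((wordProd (subword L (· ∈ K)))⁻¹ (hi i)) := by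
    have : subword (i :: L) (fun k => k ∈ J ∧ (0 : Fin (L.length + 1)) < k) =
        subword L (· ∈ K) := by
      refine (subword_cons i L _).trans ?_
      rw [if_neg (by simp)]
      exact subword_congr L fun k => by simp [hJ]
    unfold skewFactor
    rw [this]
    rfl
  rw [skewTerm_eq, skewTerm_eq]
  have : List.finRange (i :: L).length = 0 :: (List.finRange L.length).map Fin.succ :=
    List.finRange_succ
  rw [this, List.filter_cons, List.filter_map]
  have hf : ((List.finRange L.length).filter
      ((fun j : Fin (L.length + 1) => decide (j ∉ J)) ∘ Fin.succ)) =
      (List.finRange L.length).filter (fun j => decide (j ∉ K)) := by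
    simp only [Function.comp_def, hJ]
  have hm : ((List.map Fin.succ ((List.finRange L.length).filter
      (fun j => decide (j ∉ K)))).map (skewFactor (i :: L) J)) =
      ((List.finRange L.length).filter (fun j => decide (j ∉ K))).map (skewFactor L K) := by
    rw [List.map_map]
    exact List.map_congr_left fun j _ => hsucc j
  by_cases h0 : 0 ∈ J
  · rw [if_neg (by simpa using h0), if_pos h0, one_mul]
    exact congrArg List.prod ((congrArg (fun l => (l.map Fin.succ).map (skewFactor (i :: L) J)) hf).trans hm)
  · rw [if_pos (by simpa using h0), if_neg h0, List.map_cons, List.prod_cons]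
    exact congrArg₂ (· * ·) hzero
      (congrArg List.prod ((congrArg (fun l => (l.map Fin.succ).map (skewFactor (i :: L) J)) hf).trans hm))

theorem skewOfWord_nil (v : Equiv.Perm (Fin n)) :
    skewOfWord [] v = if v = 1 then 1 else 0 := by
  classical
  have hs : ∀ J : Finset (Fin ([] : List (Fin (n - 1))).length), subword [] (· ∈ J) = [] :=
    fun J => rfl
  unfold skewOfWord
  simp only [hs, isReducedExpr_nil]
  rw [Finset.sum_filter]
  have : (Finset.univ : Finset (Finset (Fin ([] : List (Fin (n - 1))).length))) = {∅} := rfl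
  rw [this, Finset.sum_singleton]
  rfl

theorem skewOfWord_cons (i : Fin (n - 1)) (L : List (Fin (n - 1))) :
    skewOfWord (i :: L) = skewOp x i (skewOfWord L) := by
  classical
  funext v
  have h1 : ∀ (J : Finset (Fin (L.length + 1))), 0 ∈ J → ∀ K : Finset (Fin L.length),
      (∀ k, k.succ ∈ J ↔ k ∈ K) → subword (i :: L) (· ∈ J) = i :: subword L (· ∈ K) := by
    intro J h0 K hJ
    refine (subword_cons i L _).trans ?_
    rw [if_pos h0, subword_congr L hJ]
  have h2 : ∀ (J : Finset (Fin (L.length + 1))), 0 ∉ J → ∀ K : Finset (Fin L.length),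
      (∀ k, k.succ ∈ J ↔ k ∈ K) → subword (i :: L) (· ∈ J) = subword L (· ∈ K) := by
    intro J h0 K hJ
    refine (subword_cons i L _).trans ?_
    rw [if_neg h0, subword_congr L hJ]
  have m1 : ∀ (K : Finset (Fin L.length)) k,
      k.succ ∈ insert 0 (K.map (Fin.succEmb L.length)) ↔ k ∈ K := by intro K k; simp
  have m2 : ∀ (K : Finset (Fin L.length)) k,
      k.succ ∈ K.map (Fin.succEmb L.length) ↔ k ∈ K := by intro K k; simp
  have z2 : ∀ (K : Finset (Fin L.length)), 0 ∉ K.map (Fin.succEmb L.length) := by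
    intro K; simp
  unfold skewOp
  rw [skewOfWord, Finset.sum_filter]
  refine (sum_finset_fin_succ _).trans ?_
  congr 1
  · by_cases hd : IsDesc i v
    · refine Eq.trans ?_ (if_pos hd).symm
      rw [skewOfWord, Finset.sum_filter]
      refine Finset.sum_congr rfl fun K _ => ?_
      rw [h1 _ (Finset.mem_insert_self _ _) K (m1 K),
        skewTerm_cons i L _ K (m1 K), if_pos (Finset.mem_insert_self _ _), one_mul]
      simp only [isReducedExpr_cons, hd, true_and]
    · refine Eq.trans ?_ (if_neg hd).symm
      refine Finset.sum_eq_zero fun K _ => ?_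
      rw [h1 _ (Finset.mem_insert_self _ _) K (m1 K), if_neg]
      rw [isReducedExpr_cons]
      exact fun h => hd h.1
  · rw [skewOfWord, Finset.sum_filter, Finset.mul_sum]
    refine Finset.sum_congr rfl fun K _ => ?_
    rw [h2 _ (z2 K) K (m2 K), skewTerm_cons i L _ K (m2 K), if_neg (z2 K)]
    split_ifs with hr
    -- The letters to the right of the first position multiply to `v`, so its factor is the same for
    -- all these sets.
    · rw [hr.1]
    · rw [mul_zero]

theorem skewOfWord_eq (L : List (Fin (n - 1))) :
    skewOfWord L = (L.map (skewOp x)).prod (skewOfWord []) := by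
  induction L with
  | nil => rfl
  | cons i L ih =>
    rw [skewOfWord_cons, ih, List.map_cons, List.prod_cons]
    rfl

theorem skewOfWord_eq_of_isReducedExpr {L M : List (Fin (n - 1))} {w : Equiv.Perm (Fin n)}
    (hL : IsReducedExpr L w) (hM : IsReducedExpr M w) : skewOfWord L = skewOfWord M := by
  rw [skewOfWord_eq L, skewOfWord_eq M, prod_eq_of_isReducedExpr (skewOp x)
    (fun _ _ => skewOp_comm (isFKFamily_x n)) (fun _ _ => skewOp_braid (isFKFamily_x n)) hL hM]

/-! ### Recurrence, initial values and positivity -/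

theorem xSkew_eq_skewOfWord {L : List (Fin (n - 1))} {w : Equiv.Perm (Fin n)}
    (hL : IsReducedExpr L w) : xSkew w = skewOfWord L :=
  skewOfWord_eq_of_isReducedExpr (reducedExpr_spec w) hL

theorem xSkew_simple_mul {i : Fin (n - 1)} {w : Equiv.Perm (Fin n)} (h : ¬ IsDesc i w) :
    xSkew (simple i * w) = skewOp x i (xSkew w) := by
  have : IsReducedExpr (i :: reducedExpr w) (simple i * w) := by
    rw [isReducedExpr_cons, isDesc_simple_mul, simple_mul_cancel]
    exact ⟨h, reducedExpr_spec w⟩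
  rw [xSkew_eq_skewOfWord this, skewOfWord_cons]
  rfl

/-- Here `x_{w/·}` already lies in the image of the operator, whose square is zero. -/
theorem skewOp_xSkew_of_isDesc {i : Fin (n - 1)} {w : Equiv.Perm (Fin n)} (h : IsDesc i w) :
    skewOp x i (xSkew w) = 0 := by
  have := xSkew_simple_mul (i := i) (w := simple i * w)
    fun h' => (isDesc_simple_mul i w).1 h' h
  rw [simple_mul_cancel] at this
  rw [this]
  exact skewOp_skewOp (isFKFamily_x n) i _

theorem xSkew_of_not_isDesc {i : Fin (n - 1)} {v w : Equiv.Perm (Fin n)} (hv : ¬ IsDesc i v)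
    (hw : ¬ IsDesc i w) :
    xSkew w v = x (v⁻¹ (lo i)) (v⁻¹ (hi i)) * xSkew w (simple i * v) +
      xSkew (simple i * w) (simple i * v) := by
  rw [xSkew_simple_mul hw]
  exact skewOp_simple_mul (isFKFamily_x n) hv _

theorem xSkew_of_isDesc {i : Fin (n - 1)} {v w : Equiv.Perm (Fin n)} (hv : ¬ IsDesc i v)
    (hw : IsDesc i w) :
    xSkew w v = x (v⁻¹ (lo i)) (v⁻¹ (hi i)) * xSkew w (simple i * v) := by
  have h := skewOp_simple_mul (isFKFamily_x n) hv (xSkew w)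
  have h0 := congrFun (skewOp_xSkew_of_isDesc hw) (simple i * v)
  exact h.trans ((congrArg (_ + ·) h0).trans (add_zero _))

theorem skewOfWord_of_length_le {L : List (Fin (n - 1))} {v w : Equiv.Perm (Fin n)}
    (hL : IsReducedExpr L w) (h : L.length ≤ (inversions v).card) :
    skewOfWord L v = if v = w then 1 else 0 := by
  induction L generalizing v w with
  | nil =>
    rw [isReducedExpr_nil.1 hL, skewOfWord_nil]
  | cons i L ih =>
    rw [isReducedExpr_cons] at hL
    rw [List.length_cons] at h
    -- The tail is strictly shorter than `ℓ(v)`, which kills the term in which the first letter is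
    -- omitted.
    have hne : v ≠ simple i * w := by
      rintro rfl
      have := (isReducedExpr_iff.1 hL.2).2
      omega
    rw [skewOfWord_cons]
    by_cases hd : IsDesc i v
    · have := card_inversions_of_isDesc hd
      rw [skewOp_apply_of_isDesc _ hd, ih hL.2 (by omega), ih hL.2 (by omega), if_neg hne, mul_zero,
        add_zero]
      simp only [mul_right_inj]
    · rw [if_neg (by rintro rfl; exact hd hL.1)]
      rw [skewOp_apply_of_not_isDesc _ hd, ih hL.2 (by omega), if_neg hne, mul_zero]

theorem xSkew_of_len_le {v w : Equiv.Perm (Fin n)} (h : len w ≤ len v) :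
    xSkew w v = if v = w then 1 else 0 :=
  skewOfWord_of_length_le (reducedExpr_spec w) (by rwa [← len_eq_card_inversions])

theorem one_mem_FKpos : (1 : FK n) ∈ FKpos n :=
  Submodule.subset_span (one_mem (Submonoid.closure _))

theorem x_mul_mem_FKpos {a b : Fin n} (hab : a < b) {y : FK n} (hy : y ∈ FKpos n) :
    x a b * y ∈ FKpos n := by
  unfold FKpos at hy ⊢
  induction hy using Submodule.span_induction with
  | mem z hz => exact Submodule.subset_span (mul_mem (Submonoid.subset_closure ⟨a, b, hab, rfl⟩) hz)
  | zero => rw [mul_zero]; exact zero_mem _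
  | add y z _ _ hy hz => rw [mul_add]; exact add_mem hy hz
  | smul c y _ hy =>
    -- Nonnegative reals act through `ℂ`, whose scalars commute with multiplication in the algebra.
    have hc : x a b * (((c : ℝ) : ℂ) • y) = ((c : ℝ) : ℂ) • (x a b * y) := mul_smul_comm _ _ _
    exact Set.mem_of_eq_of_mem hc (Submodule.smul_mem _ c hy)

/-- The induction is on the number of non-inversions of `v`. At the longest `v` the initial values
apply; otherwise some `i` is not a descent, and every term of the recurrence has `s_i v` below. -/
theorem xSkew_mem_FKpos (v w : Equiv.Perm (Fin n)) : xSkew w v ∈ FKpos n := by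
  induction hk : (Finset.univ.filter fun p : Fin n × Fin n => p.1 < p.2).card -
    (inversions v).card generalizing v w with
  | zero =>
    have h := card_inversions_le w
    rw [xSkew_of_len_le (by rw [len_eq_card_inversions, len_eq_card_inversions]; omega)]
    split_ifs
    · exact one_mem_FKpos
    · exact zero_mem _
  | succ k ih =>
    obtain ⟨i, hv⟩ : ∃ i, ¬ IsDesc i v := by
      by_contra! h
      rw [inversions_of_forall_isDesc h] at hk
      omega
    have hc := card_inversions_simple_mul hv
    have hlt : v⁻¹ (lo i) < v⁻¹ (hi i) :=
      lt_of_le_of_ne (not_lt.1 hv) fun e => (lo_lt_hi i).ne (v⁻¹.injective e)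
    have h1 := x_mul_mem_FKpos hlt (ih (simple i * v) w (by omega))
    by_cases hw : IsDesc i w
    · rwa [xSkew_of_isDesc hv hw]
    · rw [xSkew_of_not_isDesc hv hw]
      exact add_mem h1 (ih _ _ (by omega))

end Skew

end SkewDD

theorem corollary3p7 (n : ℕ) (v w : Equiv.Perm (Fin n)) :
    -- `x_{w/v}` can be computed from any reduced expression for `w`
    (∀ L : List (Fin (n - 1)), SkewDD.IsReducedExpr L w →
      SkewDD.xSkew w v = SkewDD.skewOfWord L v) ∧
    -- the recurrence
    (∀ (i : Fin (n - 1)) (a b : Fin n) (v' w' : Equiv.Perm (Fin n)),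
      a = v⁻¹ (SkewDD.lo i) → b = v⁻¹ (SkewDD.hi i) → a < b →
      v' = SkewDD.simple i * v → w' = SkewDD.simple i * w →
      (SkewDD.BruhatCovBy w w' →
        SkewDD.xSkew w v = SkewDD.x a b * SkewDD.xSkew w v' + SkewDD.xSkew w' v') ∧
      (¬ SkewDD.BruhatCovBy w w' →
        SkewDD.xSkew w v = SkewDD.x a b * SkewDD.xSkew w v')) ∧
    -- its initial values
    (SkewDD.len w ≤ SkewDD.len v → SkewDD.xSkew w v = if v = w then 1 else 0) ∧
    -- positivity
    SkewDD.xSkew w v ∈ SkewDD.FKpos n := by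
  refine ⟨fun L hL => congrFun (SkewDD.xSkew_eq_skewOfWord hL) v, ?_, SkewDD.xSkew_of_len_le,
    SkewDD.xSkew_mem_FKpos v w⟩
  rintro i a b v' w' rfl rfl hab rfl rfl
  -- Both cases are now about whether `i` is a descent of `w`, while `a < b` says that it is none of
  -- `v`.
  rw [SkewDD.bruhatCovBy_simple_mul, not_not]
  exact ⟨SkewDD.xSkew_of_not_isDesc hab.not_gt, SkewDD.xSkew_of_isDesc hab.not_gt⟩
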